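/- Let $n$ be a number of channels, $q\in\mathbb{R}$ and $U\in\mathcal{U}(2n)$ a unitary matrix. Let $H_{Q,U}$, $Q=\{q\}$, be the operator in $L^2(\mathbb{R},\mathbb{C}^n)$ that acts as $f\mapsto -f''$ off $q$ on the domain of all $f\in W^{2,2}(\mathbb{R}\setminus\{q\},\mathbb{C}^n)$ satisfying the boundary condition $$(1-U)\begin{pmatrix} f(q-)\\ f(q+)\end{pmatrix}=i(1+U)\begin{pmatrix} -f'(q-)\\ f'(q+)\end{pmatrix}.$$ Call $H_{Q,U}$ \emph{reducible} if there is a unitary $n\times n$ matrix $\Theta$ such that the unitary transformation $f\mapsto\Theta f$ of $L^2(\mathbb{R},\mathbb{C}^n)$, $(\Theta f)(x)=\Theta f(x)$, transforms $H_{Q,U}$ into a direct sum of $n$ one-channel Hamiltonians $H_{Q,V_1},\dots,H_{Q,V_n}$ in $L^2(\mathbb{R})$, with $V_1,\dots,V_n\in\mathcal{U}(2)$. Call a function $g$ \emph{anticontinuous} at $q$ if the one-sided limits $g(q\pm)$ exist and $g(q+)+g(q-)=0$. Corollary (continuity/anticontinuity criterion). If one of the following conditions is satisfied: (1) all functions in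 $\operatorname{dom} H_{Q,U}$ are continuous at $q$; (2) all functions in $\operatorname{dom} H_{Q,U}$ are anticontinuous at $q$; (3) the derivatives $f'$ (taken on $\mathbb{R}\setminus\{q\}$) of all functions $f\in\operatorname{dom} H_{Q,U}$ are continuous at $q$, i.e. $f'(q-)=f'(q+)$; (4) the derivatives $f'$ (taken on $\mathbb{R}\setminus\{q\}$) of all functions $f\in\operatorname{dom} H_{Q,U}$ are anticontinuous at $q$; then $H_{Q,U}$ is reducible. -/

import Mathlib

open scoped Topology ContDiff ENNReal

noncomputable section

namespace CoupledChannels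

open MeasureTheory Filter

/-- The Hilbert space `L²(ℝ, ℂⁿ)` of `n` channels. -/
abbrev L2 (n : ℕ) : Type := Lp (EuclideanSpace ℂ (Fin n)) 2 (volume : Measure ℝ)

/-! ### Weak derivatives on `ℝ ∖ {q}` and one-sided boundary values -/

/-- `g` is the weak derivative of `f` on the open set `ℝ ∖ {q}`. -/
def HasWeakDeriv {n : ℕ} (q : ℝ) (f g : L2 n) : Prop :=
  ∀ φ : ℝ → ℝ, ContDiff ℝ ∞ φ → HasCompactSupport φ → tsupport φ ⊆ {q}ᶜ →
    ∫ x, deriv φ x • f x = -∫ x, φ x • g x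

/-- The class `f` has the limit `v` along `l`, for a suitable representative.
For `l = 𝓝[<] q` and `l = 𝓝[>] q` these are the one-sided limits `f(q-)` and `f(q+)`. -/
def HasLimit {n : ℕ} (l : Filter ℝ) (f : L2 n) (v : EuclideanSpace ℂ (Fin n)) : Prop :=
  ∃ g : ℝ → EuclideanSpace ℂ (Fin n), f =ᵐ[volume] g ∧ Tendsto g l (𝓝 v)

/-- The class `f` has a representative that is continuous at `q`. -/
def IsContinuousAt {n : ℕ} (q : ℝ) (f : L2 n) : Prop :=
  ∃ g : ℝ → EuclideanSpace ℂ (Fin n), f =ᵐ[volume] g ∧ ContinuousAt g q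

/-- The limits `f(q-)` and `f(q+)` exist and `f(q+) + f(q-) = 0`. -/
def IsAnticontinuousAt {n : ℕ} (q : ℝ) (f : L2 n) : Prop :=
  ∃ a b : EuclideanSpace ℂ (Fin n),
    HasLimit (𝓝[<] q) f a ∧ HasLimit (𝓝[>] q) f b ∧ b + a = 0

/-- `f` lies in the Sobolev space `W^{2,2}(ℝ ∖ {q}, ℂⁿ)`, with weak derivatives `f'` and `f''`
(all three are square integrable, being elements of `L2 n`). -/
def HasTwoWeakDerivs {n : ℕ} (q : ℝ) (f f' f'' : L2 n) : Prop :=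
  HasWeakDeriv q f f' ∧ HasWeakDeriv q f' f''

/-- The vector `(a, b) ∈ ℂⁿ ⊕ ℂⁿ = ℂ²ⁿ`. -/
def pair {n : ℕ} (a b : EuclideanSpace ℂ (Fin n)) : Fin n ⊕ Fin n → ℂ := Sum.elim a b

/-- The boundary condition `(1 - U) Γ₁ f = i (1 + U) Γ₂ f` at `q`, where
`Γ₁ f = (f(q-), f(q+))` and `Γ₂ f = (-f'(q-), f'(q+))`. -/
def BoundaryCondition {n : ℕ} (q : ℝ) (U : Matrix.unitaryGroup (Fin n ⊕ Fin n) ℂ)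
    (f f' : L2 n) : Prop :=
  ∃ a b a' b' : EuclideanSpace ℂ (Fin n),
    HasLimit (𝓝[<] q) f a ∧ HasLimit (𝓝[>] q) f b ∧
    HasLimit (𝓝[<] q) f' a' ∧ HasLimit (𝓝[>] q) f' b' ∧
    Matrix.mulVec (1 - (U : Matrix (Fin n ⊕ Fin n) (Fin n ⊕ Fin n) ℂ)) (pair a b) =
      Complex.I • Matrix.mulVec (1 + (U : Matrix (Fin n ⊕ Fin n) (Fin n ⊕ Fin n) ℂ))
        (pair (-a') b')

/-! ### Linearity and uniqueness -/

section Helpers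

variable {n : ℕ} {q : ℝ}

theorem integrable_smul {φ : ℝ → ℝ} (hφ : Continuous φ) (hc : HasCompactSupport φ) (f : L2 n) :
    Integrable (fun x => φ x • f x) :=
  ((Lp.memLp f).locallyIntegrable (by norm_num)).integrable_smul_left_of_hasCompactSupport hφ hc

theorem HasWeakDeriv.add {f g f₁ g₁ : L2 n} (h : HasWeakDeriv q f g)
    (h₁ : HasWeakDeriv q f₁ g₁) : HasWeakDeriv q (f + f₁) (g + g₁) := by
  intro φ hφ hc hs
  have hd : Continuous (deriv φ) := hφ.continuous_deriv (by simp)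
  have e1 : ∫ x, deriv φ x • (f + f₁ : L2 n) x = ∫ x, (deriv φ x • f x + deriv φ x • f₁ x) := by
    refine integral_congr_ae ?_
    filter_upwards [Lp.coeFn_add f f₁] with x hx
    rw [hx, Pi.add_apply, smul_add]
  have e2 : ∫ x, φ x • (g + g₁ : L2 n) x = ∫ x, (φ x • g x + φ x • g₁ x) := by
    refine integral_congr_ae ?_
    filter_upwards [Lp.coeFn_add g g₁] with x hx
    rw [hx, Pi.add_apply, smul_add]
  rw [e1, e2, integral_add (integrable_smul hd hc.deriv f) (integrable_smul hd hc.deriv f₁),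
    integral_add (integrable_smul hφ.continuous hc g) (integrable_smul hφ.continuous hc g₁),
    h φ hφ hc hs, h₁ φ hφ hc hs, neg_add]

theorem HasWeakDeriv.smul {f g : L2 n} (c : ℂ) (h : HasWeakDeriv q f g) :
    HasWeakDeriv q (c • f) (c • g) := by
  intro φ hφ hc hs
  have e1 : ∫ x, deriv φ x • (c • f : L2 n) x = ∫ x, c • (deriv φ x • f x) := by
    refine integral_congr_ae ?_
    filter_upwards [Lp.coeFn_smul c f] with x hx
    rw [hx, Pi.smul_apply, smul_comm]
  have e2 : ∫ x, φ x • (c • g : L2 n) x = ∫ x, c • (φ x • g x) := by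
    refine integral_congr_ae ?_
    filter_upwards [Lp.coeFn_smul c g] with x hx
    rw [hx, Pi.smul_apply, smul_comm]
  rw [e1, e2, integral_smul, integral_smul, h φ hφ hc hs, smul_neg]

theorem HasWeakDeriv.zero : HasWeakDeriv q (0 : L2 n) 0 := by
  have h : ∀ ψ : ℝ → ℝ, ∫ x, ψ x • (0 : L2 n) x = 0 := by
    intro ψ
    refine integral_eq_zero_of_ae ?_
    filter_upwards [Lp.coeFn_zero (EuclideanSpace ℂ (Fin n)) 2 (volume : Measure ℝ)] with x hx
    rw [hx]
    simp
  intro φ _ _ _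
  rw [h, h, neg_zero]

theorem HasWeakDeriv.unique {f g₁ g₂ : L2 n} (h₁ : HasWeakDeriv q f g₁)
    (h₂ : HasWeakDeriv q f g₂) : g₁ = g₂ := by
  have key : ∀ᵐ x ∂(volume : Measure ℝ), x ∈ ({q}ᶜ : Set ℝ) → g₁ x - g₂ x = 0 := by
    refine isOpen_compl_singleton.ae_eq_zero_of_integral_contDiff_smul_eq_zero
      (f := fun x => g₁ x - g₂ x) ?_ ?_
    · exact LocallyIntegrable.locallyIntegrableOn
        (((Lp.memLp g₁).locallyIntegrable (by norm_num)).sub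
          ((Lp.memLp g₂).locallyIntegrable (by norm_num))) _
    · intro φ hφ hc hs
      simp only [smul_sub]
      rw [integral_sub (integrable_smul hφ.continuous hc g₁)
        (integrable_smul hφ.continuous hc g₂), sub_eq_zero, ← neg_inj, ← h₁ φ hφ hc hs,
        ← h₂ φ hφ hc hs]
  refine Lp.ext ?_
  filter_upwards [key, compl_mem_ae_iff.2 (measure_singleton (μ := (volume : Measure ℝ)) q)]
    with x hx hq
  exact sub_eq_zero.1 (hx hq)

theorem HasLimit.add {l : Filter ℝ} {f g : L2 n} {v w : EuclideanSpace ℂ (Fin n)}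
    (hf : HasLimit l f v) (hg : HasLimit l g w) : HasLimit l (f + g) (v + w) := by
  obtain ⟨f₀, e, t⟩ := hf
  obtain ⟨g₀, e', t'⟩ := hg
  exact ⟨f₀ + g₀, (Lp.coeFn_add f g).trans (e.add e'), t.add t'⟩

theorem HasLimit.smul {l : Filter ℝ} {f : L2 n} {v : EuclideanSpace ℂ (Fin n)} (c : ℂ)
    (hf : HasLimit l f v) : HasLimit l (c • f) (c • v) := by
  obtain ⟨f₀, e, t⟩ := hf
  exact ⟨c • f₀, (Lp.coeFn_smul c f).trans (e.const_smul c), t.const_smul c⟩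

theorem HasLimit.zero {l : Filter ℝ} : HasLimit l (0 : L2 n) 0 :=
  ⟨0, Lp.coeFn_zero _ _ _, tendsto_const_nhds⟩

theorem pair_add (a b c d : EuclideanSpace ℂ (Fin n)) :
    pair (a + c) (b + d) = pair a b + pair c d := by
  ext i; cases i <;> simp [pair]

theorem pair_smul (c : ℂ) (a b : EuclideanSpace ℂ (Fin n)) :
    pair (c • a) (c • b) = c • pair a b := by
  ext i; cases i <;> simp [pair]

theorem pair_zero : pair (0 : EuclideanSpace ℂ (Fin n)) 0 = 0 := by
  ext i; cases i <;> simp [pair]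

theorem BoundaryCondition.add {U : Matrix.unitaryGroup (Fin n ⊕ Fin n) ℂ} {f f' g g' : L2 n}
    (hf : BoundaryCondition q U f f') (hg : BoundaryCondition q U g g') :
    BoundaryCondition q U (f + g) (f' + g') := by
  obtain ⟨a, b, a', b', h1, h2, h3, h4, h⟩ := hf
  obtain ⟨c, d, c', d', k1, k2, k3, k4, k⟩ := hg
  refine ⟨a + c, b + d, a' + c', b' + d', h1.add k1, h2.add k2, h3.add k3, h4.add k4, ?_⟩
  rw [neg_add, pair_add, pair_add, Matrix.mulVec_add, Matrix.mulVec_add, h, k, smul_add]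

theorem BoundaryCondition.smul {U : Matrix.unitaryGroup (Fin n ⊕ Fin n) ℂ} {f f' : L2 n} (c : ℂ)
    (hf : BoundaryCondition q U f f') : BoundaryCondition q U (c • f) (c • f') := by
  obtain ⟨a, b, a', b', h1, h2, h3, h4, h⟩ := hf
  refine ⟨c • a, c • b, c • a', c • b', h1.smul c, h2.smul c, h3.smul c, h4.smul c, ?_⟩
  rw [← smul_neg, pair_smul, pair_smul, Matrix.mulVec_smul, Matrix.mulVec_smul, h, smul_comm]

theorem BoundaryCondition.zero {U : Matrix.unitaryGroup (Fin n ⊕ Fin n) ℂ} :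
    BoundaryCondition q U (0 : L2 n) 0 := by
  refine ⟨0, 0, 0, 0, HasLimit.zero, HasLimit.zero, HasLimit.zero, HasLimit.zero, ?_⟩
  rw [neg_zero, pair_zero, Matrix.mulVec_zero, Matrix.mulVec_zero, smul_zero]

end Helpers

/-! ### The Hamiltonians -/

/-- The domain of `H_{{q},U}`: all `f ∈ W^{2,2}(ℝ ∖ {q}, ℂⁿ)` that satisfy the boundary
condition given by `U` at `q`. -/
def domain {n : ℕ} (q : ℝ) (U : Matrix.unitaryGroup (Fin n ⊕ Fin n) ℂ) :
    Submodule ℂ (L2 n) where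
  carrier := {f | ∃ f' f'' : L2 n, HasTwoWeakDerivs q f f' f'' ∧ BoundaryCondition q U f f'}
  add_mem' := by
    rintro f g ⟨f', f'', ⟨h1, h2⟩, h⟩ ⟨g', g'', ⟨k1, k2⟩, k⟩
    exact ⟨f' + g', f'' + g'', ⟨h1.add k1, h2.add k2⟩, h.add k⟩
  zero_mem' := ⟨0, 0, ⟨HasWeakDeriv.zero, HasWeakDeriv.zero⟩, BoundaryCondition.zero⟩
  smul_mem' := by
    rintro c f ⟨f', f'', ⟨h1, h2⟩, h⟩
    exact ⟨c • f', c • f'', ⟨h1.smul c, h2.smul c⟩, h.smul c⟩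

theorem exists_second {n : ℕ} {q : ℝ} {U : Matrix.unitaryGroup (Fin n ⊕ Fin n) ℂ}
    (f : domain q U) : ∃ f'' : L2 n, ∃ f' : L2 n, HasTwoWeakDerivs q (f : L2 n) f' f'' := by
  obtain ⟨f', f'', h, -⟩ := f.2
  exact ⟨f'', f', h⟩

/-- The second weak derivative of an element of the domain. -/
def secondDeriv {n : ℕ} {q : ℝ} {U : Matrix.unitaryGroup (Fin n ⊕ Fin n) ℂ}
    (f : domain q U) : L2 n := (exists_second f).choose

theorem secondDeriv_eq {n : ℕ} {q : ℝ} {U : Matrix.unitaryGroup (Fin n ⊕ Fin n) ℂ}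
    (f : domain q U) {f' f'' : L2 n} (h : HasTwoWeakDerivs q (f : L2 n) f' f'') :
    secondDeriv f = f'' := by
  obtain ⟨g', k1, k2⟩ := (exists_second f).choose_spec
  obtain rfl := k1.unique h.1
  exact k2.unique h.2

/-- The Hamiltonian `H_{{q},U}` of `n` channels coupled at the point `q`: it acts as `f ↦ -f''`
off `q` on the functions that satisfy the boundary condition given by `U` at `q`. -/
def hamiltonian {n : ℕ} (q : ℝ) (U : Matrix.unitaryGroup (Fin n ⊕ Fin n) ℂ) :
    L2 n →ₗ.[ℂ] L2 n where
  domain := domain q U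
  toFun :=
    { toFun := fun f => -secondDeriv f
      map_add' := by
        intro f g
        obtain ⟨f', f'', ⟨h1, h2⟩, -⟩ := f.2
        obtain ⟨g', g'', ⟨k1, k2⟩, -⟩ := g.2
        rw [secondDeriv_eq f ⟨h1, h2⟩, secondDeriv_eq g ⟨k1, k2⟩,
          secondDeriv_eq (f + g) (f' := f' + g') (f'' := f'' + g'') ⟨h1.add k1, h2.add k2⟩,
          neg_add]
      map_smul' := by
        intro c f
        obtain ⟨f', f'', ⟨h1, h2⟩, -⟩ := f.2
        rw [secondDeriv_eq f ⟨h1, h2⟩,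
          secondDeriv_eq (c • f) (f' := c • f') (f'' := c • f'') ⟨h1.smul c, h2.smul c⟩,
          RingHom.id_apply, smul_neg] }

/-! ### Reducibility -/

/-- Pointwise multiplication `(M f)(x) = M (f x)` by a matrix. -/
def mulMatrix {m n : ℕ} (M : Matrix (Fin m) (Fin n) ℂ) : L2 n →L[ℂ] L2 m :=
  (LinearMap.toContinuousLinearMap (Matrix.toEuclideanLin M)).compLpL 2 volume

/-- The `s`-th component `f ↦ f_s`, from `L²(ℝ, ℂⁿ)` to `L²(ℝ, ℂ¹)`. -/
def component {n : ℕ} (s : Fin n) : L2 n →L[ℂ] L2 1 := mulMatrix (Matrix.single 0 s 1)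

/-- The embedding of `L²(ℝ, ℂ¹)` into `L²(ℝ, ℂⁿ)` as the `s`-th channel. -/
def inclusion {n : ℕ} (s : Fin n) : L2 1 →L[ℂ] L2 n := mulMatrix (Matrix.single s 0 1)

/-- The direct sum of `n` one-channel operators: `f` is in its domain iff every component `f_s`
is in the domain of `H s`, and it maps `f = (f_s)_s` to `(H s f_s)_s`. -/
def directSum {n : ℕ} (H : Fin n → (L2 1 →ₗ.[ℂ] L2 1)) : L2 n →ₗ.[ℂ] L2 n where
  domain := ⨅ s, (H s).domain.comap (component s : L2 n →ₗ[ℂ] L2 1)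
  toFun :=
    { toFun := fun f => ∑ s, inclusion s
        ((H s) ⟨component s (f : L2 n), (Submodule.mem_iInf _).1 f.2 s⟩)
      map_add' := by
        intro f g
        rw [← Finset.sum_add_distrib]
        refine Finset.sum_congr rfl fun s _ => ?_
        rw [← map_add, ← LinearPMap.map_add]
        congr 3
        exact map_add (component s) (f : L2 n) (g : L2 n)
      map_smul' := by
        intro c f
        rw [RingHom.id_apply, Finset.smul_sum]
        refine Finset.sum_congr rfl fun s _ => ?_
        rw [← map_smul, ← LinearPMap.map_smul]
        congr 3
        exact map_smul (component s) c (f : L2 n) }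

/-- The operator `Θ H Θ⁻¹`, where the unitary matrix `Θ` acts by `(Θ f)(x) = Θ (f x)`. -/
def conjugate {n : ℕ} (Θ : Matrix.unitaryGroup (Fin n) ℂ) (H : L2 n →ₗ.[ℂ] L2 n) :
    L2 n →ₗ.[ℂ] L2 n where
  domain := H.domain.comap
    (mulMatrix ((Θ⁻¹ : Matrix.unitaryGroup (Fin n) ℂ) : Matrix (Fin n) (Fin n) ℂ) :
      L2 n →ₗ[ℂ] L2 n)
  toFun :=
    { toFun := fun f => mulMatrix (Θ : Matrix (Fin n) (Fin n) ℂ)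
        (H ⟨mulMatrix ((Θ⁻¹ : Matrix.unitaryGroup (Fin n) ℂ) : Matrix (Fin n) (Fin n) ℂ)
          (f : L2 n), f.2⟩)
      map_add' := by
        intro f g
        rw [← map_add, ← LinearPMap.map_add]
        congr 3
        exact map_add (mulMatrix _) (f : L2 n) (g : L2 n)
      map_smul' := by
        intro c f
        rw [RingHom.id_apply, ← map_smul, ← LinearPMap.map_smul]
        congr 3
        exact map_smul (mulMatrix _) c (f : L2 n) }

/-- The operator `H` is reducible (for couplings at `q`): some unitary `n × n` matrix `Θ`,
through `f ↦ Θ f`, transforms `H` into a direct sum of `n` one-dimensional point interaction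
Hamiltonians at `q`. -/
def IsReducible {n : ℕ} (q : ℝ) (H : L2 n →ₗ.[ℂ] L2 n) : Prop :=
  ∃ (Θ : Matrix.unitaryGroup (Fin n) ℂ)
    (V : Fin n → Matrix.unitaryGroup (Fin 1 ⊕ Fin 1) ℂ),
    conjugate Θ H = directSum (fun s => hamiltonian q (V s))

end CoupledChannels

end

namespace CoupledChannels

open MeasureTheory Filter

/-! ### Normal matrices -/

/-! For every `z` in `ℂ²ⁿ`, the domain contains a function with boundary data `Γ₁ = i(1 + U)z` and
`Γ₂ = (1 - U)z`: these satisfy the boundary condition because `1 + U` and `1 - U` commute, and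
arbitrary boundary data are realised by smooth compactly supported pieces on the two half-lines
(`exists_mem_domain_boundaryValues`). A symmetry imposed on all values or derivatives at `q`
therefore says that the upper half of `U - η` is `σ` times its lower half, with `σ = ±1`; here `η =
-1` for conditions on `f` and `η = 1` for conditions on `f'`.

Unitarity then forces `U = [A, σ(A - η); σ(A - η), A]` with `A` normal and `2AA* = η(A + A*)`, that
is, with `2A - η` unitary (`eq_mirror`). All four blocks are affine functions of the single normal
matrix `A`, so a unitary `P` diagonalising `A` diagonalises them simultaneously. The channels
decouple into the 2 × 2 matrices of the same form built from the eigenvalues `d s`, which are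
unitary because `d s` inherits the quadratic identity (`isReducible_of_mirror`).

The passage from matrices to operators is `isReducible_of_intertwines`: constant matrices commute
with weak derivatives and one-sided limits, so an intertwining relation between coupling matrices
carries one domain into the other. -/

theorem exists_unitary_diagonalization {n : ℕ} (A : Matrix (Fin n) (Fin n) ℂ)
    (hA : A * A.conjTranspose = A.conjTranspose * A) :
    ∃ (P : Matrix.unitaryGroup (Fin n) ℂ) (d : Fin n → ℂ),
      A * (P : Matrix (Fin n) (Fin n) ℂ) = P * Matrix.diagonal d := by
  classical
  -- Real and imaginary parts up to a factor: `2A = X - iY`, with `X` and `Y` Hermitian. They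
  -- commute because `A` is normal, so they have a joint orthonormal eigenbasis.
  set X : Matrix (Fin n) (Fin n) ℂ := A + A.conjTranspose with hX
  set Y : Matrix (Fin n) (Fin n) ℂ := Complex.I • (A - A.conjTranspose) with hY
  have hXs : (Matrix.toEuclideanLin X).IsSymmetric := by
    rw [Matrix.isSymmetric_toEuclideanLin_iff, Matrix.IsHermitian, hX, Matrix.conjTranspose_add,
      Matrix.conjTranspose_conjTranspose, add_comm]
  have hYs : (Matrix.toEuclideanLin Y).IsSymmetric := by
    rw [Matrix.isSymmetric_toEuclideanLin_iff, Matrix.IsHermitian, hY, Matrix.conjTranspose_smul,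
      Matrix.conjTranspose_sub, Matrix.conjTranspose_conjTranspose]
    simp only [RCLike.star_def, Complex.conj_I, neg_smul, ← smul_neg, neg_sub]
  have hXY : X * Y = Y * X := by
    simp only [hX, hY, Matrix.mul_smul, Matrix.smul_mul, add_mul, mul_add, sub_mul, mul_sub, hA]
  have hc : Commute (Matrix.toEuclideanLin X) (Matrix.toEuclideanLin Y) := by
    refine LinearMap.ext fun v => ?_
    simp only [Module.End.mul_apply, Matrix.toLpLin_apply, Matrix.mulVec_mulVec, hXY]
  have hof := LinearMap.IsSymmetric.orthogonalFamily_eigenspace_inf_eigenspace hXs hYs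
  have hint := LinearMap.IsSymmetric.directSum_isInternal_of_commute hXs hYs hc
  set V : ℂ × ℂ → Submodule ℂ (EuclideanSpace ℂ (Fin n)) := fun i =>
    Module.End.eigenspace (Matrix.toEuclideanLin X) i.2 ⊓
      Module.End.eigenspace (Matrix.toEuclideanLin Y) i.1
  -- The pairs of candidate eigenvalues range over the infinite set `ℂ × ℂ`; only finitely many
  -- joint eigenspaces are nonzero, and a basis subordinate to them needs a finite index.
  have : Finite {i // V i ≠ ⊥} :=
    (WellFoundedGT.finite_ne_bot_of_iSupIndep hint.submodule_iSupIndep).to_subtype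
  have : Fintype {i // V i ≠ ⊥} := Fintype.ofFinite _
  have hint' := DirectSum.isInternal_ne_bot_iff.2 hint
  have hof' := hof.comp (Subtype.val_injective (p := fun i => V i ≠ ⊥))
  have hn : Module.finrank ℂ (EuclideanSpace ℂ (Fin n)) = n := finrank_euclideanSpace_fin
  let b := hint'.subordinateOrthonormalBasis hn hof'
  let ix := fun j => (hint'.subordinateOrthonormalBasisIndex hn j hof').1
  have hb : ∀ j, b j ∈ V (ix j) := fun j =>
    hint'.subordinateOrthonormalBasis_subordinate hn j hof'
  refine ⟨⟨(EuclideanSpace.basisFun (Fin n) ℂ).toBasis.toMatrix b,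
    OrthonormalBasis.toMatrix_orthonormalBasis_mem_unitary _ _⟩,
    fun j => (2 : ℂ)⁻¹ * ((ix j).2 - Complex.I * (ix j).1), ?_⟩
  have h2 : A = (2 : ℂ)⁻¹ • (X - Complex.I • Y) := by
    rw [hX, hY, smul_smul, Complex.I_mul_I]
    ext i j
    simp
    ring
  ext i j
  obtain ⟨h3, h4⟩ := Submodule.mem_inf.1 (hb j)
  rw [Module.End.mem_eigenspace_iff] at h3 h4
  have h3' := congrArg (fun v : EuclideanSpace ℂ (Fin n) => v i) h3
  have h4' := congrArg (fun v : EuclideanSpace ℂ (Fin n) => v i) h4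
  simp only [Matrix.toLpLin_apply, PiLp.smul_apply, smul_eq_mul, Matrix.mulVec, dotProduct]
    at h3' h4'
  rw [Matrix.mul_diagonal, h2, Matrix.smul_mul, Matrix.sub_mul, Matrix.smul_mul]
  simp only [Matrix.smul_apply, Matrix.sub_apply, Matrix.mul_apply, Module.Basis.toMatrix_apply,
    smul_eq_mul, OrthonormalBasis.coe_toBasis_repr_apply, EuclideanSpace.basisFun_repr]
  rw [h3', h4']
  ring


/-! ### Multiplication by constant matrices -/

section MulMatrix

variable {l m n : ℕ} {q : ℝ}

theorem coeFn_mulMatrix (M : Matrix (Fin m) (Fin n) ℂ) (f : L2 n) :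
    mulMatrix M f =ᵐ[volume] fun x => Matrix.toEuclideanLin M (f x) :=
  ContinuousLinearMap.coeFn_compLpL _ f

theorem mulMatrix_mulMatrix (M : Matrix (Fin l) (Fin m) ℂ) (N : Matrix (Fin m) (Fin n) ℂ)
    (f : L2 n) : mulMatrix M (mulMatrix N f) = mulMatrix (M * N) f := by
  refine Lp.ext ?_
  filter_upwards [coeFn_mulMatrix M (mulMatrix N f), coeFn_mulMatrix N f,
    coeFn_mulMatrix (M * N) f] with x h1 h2 h3
  rw [h1, h2, h3]
  simp [Matrix.toLpLin_apply, Matrix.mulVec_mulVec]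

theorem mulMatrix_one (f : L2 n) : mulMatrix (1 : Matrix (Fin n) (Fin n) ℂ) f = f := by
  refine Lp.ext ?_
  filter_upwards [coeFn_mulMatrix (1 : Matrix (Fin n) (Fin n) ℂ) f] with x h1
  rw [h1]
  simp

theorem mulMatrix_add (M N : Matrix (Fin m) (Fin n) ℂ) (f : L2 n) :
    mulMatrix (M + N) f = mulMatrix M f + mulMatrix N f := by
  refine Lp.ext ?_
  filter_upwards [coeFn_mulMatrix (M + N) f, coeFn_mulMatrix M f, coeFn_mulMatrix N f,
    Lp.coeFn_add (mulMatrix M f) (mulMatrix N f)] with x h1 h2 h3 h4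
  rw [h1, h4, Pi.add_apply, h2, h3, map_add, LinearMap.add_apply]

theorem mulMatrix_zero (f : L2 n) : mulMatrix (0 : Matrix (Fin m) (Fin n) ℂ) f = 0 := by
  simpa using mulMatrix_add (0 : Matrix (Fin m) (Fin n) ℂ) 0 f

theorem mulMatrix_sum {ι : Type*} (s : Finset ι) (M : ι → Matrix (Fin m) (Fin n) ℂ) (f : L2 n) :
    mulMatrix (∑ i ∈ s, M i) f = ∑ i ∈ s, mulMatrix (M i) f := by
  classical
  induction s using Finset.induction_on with
  | empty => simp [mulMatrix_zero]
  | insert a s ha ih => rw [Finset.sum_insert ha, Finset.sum_insert ha, mulMatrix_add, ih]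

theorem sum_inclusion_component (f : L2 n) : ∑ s, inclusion s (component s f) = f := by
  simp only [inclusion, component, mulMatrix_mulMatrix, Matrix.single_mul_single_same, mul_one]
  rw [← mulMatrix_sum, Matrix.sum_single_one, mulMatrix_one]

theorem HasWeakDeriv.mulMatrix {f g : L2 n} (M : Matrix (Fin m) (Fin n) ℂ)
    (h : HasWeakDeriv q f g) :
    HasWeakDeriv q (mulMatrix M f) (CoupledChannels.mulMatrix M g) := by
  have key : ∀ (φ : ℝ → ℝ) (f : L2 n), Continuous φ → HasCompactSupport φ →
      ∫ x, φ x • CoupledChannels.mulMatrix M f x =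
        Matrix.toEuclideanLin M (∫ x, φ x • f x) := by
    intro φ f hφ hc
    refine Eq.trans ?_ ((LinearMap.toContinuousLinearMap
      (Matrix.toEuclideanLin M)).integral_comp_comm (integrable_smul hφ hc f))
    refine integral_congr_ae ?_
    filter_upwards [coeFn_mulMatrix M f] with x hx
    rw [hx, LinearMap.coe_toContinuousLinearMap',
      LinearMap.map_smul_of_tower]
  intro φ hφ hc hs
  rw [key _ _ (hφ.continuous_deriv (by simp)) hc.deriv, key _ _ hφ.continuous hc,
    h φ hφ hc hs, map_neg]

theorem HasTwoWeakDerivs.mulMatrix {f f' f'' : L2 n} (M : Matrix (Fin m) (Fin n) ℂ)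
    (h : HasTwoWeakDerivs q f f' f'') :
    HasTwoWeakDerivs q (mulMatrix M f) (CoupledChannels.mulMatrix M f')
      (CoupledChannels.mulMatrix M f'') :=
  ⟨h.1.mulMatrix M, h.2.mulMatrix M⟩

theorem HasLimit.mulMatrix {k : Filter ℝ} {f : L2 n} {v : EuclideanSpace ℂ (Fin n)}
    (M : Matrix (Fin m) (Fin n) ℂ) (h : HasLimit k f v) :
    HasLimit k (mulMatrix M f) (Matrix.toEuclideanLin M v) := by
  obtain ⟨g, hg, t⟩ := h
  refine ⟨fun x => Matrix.toEuclideanLin M (g x), ?_,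
    ((LinearMap.toContinuousLinearMap (Matrix.toEuclideanLin M)).continuous.tendsto v).comp t⟩
  filter_upwards [coeFn_mulMatrix M f, hg] with x h1 h2
  rw [h1, h2]

/-! ### Intertwining matrices -/

/-- `M ⊕ M` intertwines the matrices `U` and `V` of two boundary conditions. -/
def Intertwines (M : Matrix (Fin m) (Fin n) ℂ) (U : Matrix.unitaryGroup (Fin n ⊕ Fin n) ℂ)
    (V : Matrix.unitaryGroup (Fin m ⊕ Fin m) ℂ) : Prop :=
  Matrix.fromBlocks M 0 0 M * (U : Matrix (Fin n ⊕ Fin n) (Fin n ⊕ Fin n) ℂ) =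
    (V : Matrix (Fin m ⊕ Fin m) (Fin m ⊕ Fin m) ℂ) * Matrix.fromBlocks M 0 0 M

theorem pair_toEuclideanLin (M : Matrix (Fin m) (Fin n) ℂ) (a b : EuclideanSpace ℂ (Fin n)) :
    pair (Matrix.toEuclideanLin M a) (Matrix.toEuclideanLin M b) =
      Matrix.mulVec (Matrix.fromBlocks M 0 0 M) (pair a b) := by
  ext i
  cases i <;> simp [pair, Matrix.fromBlocks_mulVec, Matrix.toLpLin_apply]

theorem BoundaryCondition.mulMatrix {M : Matrix (Fin m) (Fin n) ℂ}
    {U : Matrix.unitaryGroup (Fin n ⊕ Fin n) ℂ} {V : Matrix.unitaryGroup (Fin m ⊕ Fin m) ℂ}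
    (hM : Intertwines M U V) {f f' : L2 n} (h : BoundaryCondition q U f f') :
    BoundaryCondition q V (mulMatrix M f) (CoupledChannels.mulMatrix M f') := by
  obtain ⟨a, b, a', b', h1, h2, h3, h4, h⟩ := h
  refine ⟨_, _, _, _, h1.mulMatrix M, h2.mulMatrix M, h3.mulMatrix M, h4.mulMatrix M, ?_⟩
  rw [Intertwines] at hM
  rw [← map_neg, pair_toEuclideanLin, pair_toEuclideanLin, Matrix.mulVec_mulVec,
    Matrix.mulVec_mulVec, Matrix.sub_mul, Matrix.add_mul, Matrix.one_mul, ← hM]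
  have h' := congrArg (Matrix.mulVec (Matrix.fromBlocks M 0 0 M)) h
  rw [Matrix.mulVec_smul, Matrix.mulVec_mulVec, Matrix.mulVec_mulVec, Matrix.mul_sub,
    Matrix.mul_add, Matrix.mul_one] at h'
  exact h'

theorem Intertwines.mem_domain {M : Matrix (Fin m) (Fin n) ℂ}
    {U : Matrix.unitaryGroup (Fin n ⊕ Fin n) ℂ} {V : Matrix.unitaryGroup (Fin m ⊕ Fin m) ℂ}
    (hM : Intertwines M U V) {f : L2 n} (hf : f ∈ (hamiltonian q U).domain) :
    mulMatrix M f ∈ (hamiltonian q V).domain := by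
  obtain ⟨f', f'', h, hb⟩ := hf
  exact ⟨_, _, h.mulMatrix M, hb.mulMatrix hM⟩

/-- Once both functions lie in their domains, the coupling plays no role: only uniqueness of the
second weak derivative is used. -/
theorem hamiltonian_apply_of_eq_mulMatrix {M : Matrix (Fin m) (Fin n) ℂ}
    {U : Matrix.unitaryGroup (Fin n ⊕ Fin n) ℂ} {V : Matrix.unitaryGroup (Fin m ⊕ Fin m) ℂ}
    (f : (hamiltonian q U).domain) (g : (hamiltonian q V).domain)
    (hg : (g : L2 m) = mulMatrix M (f : L2 n)) :
    hamiltonian q V g = mulMatrix M (hamiltonian q U f) := by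
  obtain ⟨f', f'', h, -⟩ := f.2
  have h1 : hamiltonian q U f = -f'' := congrArg Neg.neg (secondDeriv_eq f h)
  have h2 : hamiltonian q V g = -mulMatrix M f'' := by
    refine congrArg Neg.neg (secondDeriv_eq g (f' := mulMatrix M f') ?_)
    rw [hg]
    exact h.mulMatrix M
  rw [h1, h2, map_neg]

/-- The two families of relations give the two inclusions of domains: `h1` sends `Θ⁻¹ f` to each
component of `f`, and `h2` rebuilds `Θ⁻¹ f` as a sum of embedded components. -/
theorem isReducible_of_intertwines (U : Matrix.unitaryGroup (Fin n ⊕ Fin n) ℂ)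
    (Θ : Matrix.unitaryGroup (Fin n) ℂ) (V : Fin n → Matrix.unitaryGroup (Fin 1 ⊕ Fin 1) ℂ)
    (h1 : ∀ s, Intertwines
      ((Matrix.single 0 s 1 : Matrix (Fin 1) (Fin n) ℂ) * (Θ : Matrix (Fin n) (Fin n) ℂ)) U (V s))
    (h2 : ∀ s, Intertwines
      (((Θ⁻¹ : Matrix.unitaryGroup (Fin n) ℂ) : Matrix (Fin n) (Fin n) ℂ) *
        (Matrix.single s 0 1 : Matrix (Fin n) (Fin 1) ℂ))
      (V s) U) :
    IsReducible q (hamiltonian q U) := by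
  have hΘ : (Θ : Matrix (Fin n) (Fin n) ℂ) *
      ((Θ⁻¹ : Matrix.unitaryGroup (Fin n) ℂ) : Matrix (Fin n) (Fin n) ℂ) = 1 := by
    simp
  have hcomp : ∀ (s : Fin n) (f : L2 n), component s f =
      mulMatrix ((Matrix.single 0 s 1 : Matrix (Fin 1) (Fin n) ℂ) * (Θ : Matrix (Fin n) (Fin n) ℂ))
        (mulMatrix ((Θ⁻¹ : Matrix.unitaryGroup (Fin n) ℂ) : Matrix (Fin n) (Fin n) ℂ) f) := by
    intro s f
    rw [mulMatrix_mulMatrix, Matrix.mul_assoc, hΘ, Matrix.mul_one, component]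
  refine ⟨Θ, V, ?_⟩
  have hle : ∀ f, f ∈ (conjugate Θ (hamiltonian q U)).domain →
      f ∈ (directSum fun s => hamiltonian q (V s)).domain := by
    intro f hf
    refine (Submodule.mem_iInf _).2 fun s => ?_
    rw [Submodule.mem_comap]
    have := (h1 s).mem_domain (q := q) hf
    rw [ContinuousLinearMap.coe_coe, ← hcomp] at this
    exact this
  have hge : ∀ f, f ∈ (directSum fun s => hamiltonian q (V s)).domain →
      f ∈ (conjugate Θ (hamiltonian q U)).domain := by
    intro f hf
    change mulMatrix ((Θ⁻¹ : Matrix.unitaryGroup (Fin n) ℂ) : Matrix (Fin n) (Fin n) ℂ) f ∈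
      (hamiltonian q U).domain
    rw [← sum_inclusion_component f, map_sum]
    refine Submodule.sum_mem _ fun s _ => ?_
    rw [inclusion, mulMatrix_mulMatrix]
    exact (h2 s).mem_domain ((Submodule.mem_iInf _).1 hf s)
  refine LinearPMap.ext (le_antisymm hle hge) ?_
  intro f hf hf'
  change mulMatrix (Θ : Matrix (Fin n) (Fin n) ℂ) (hamiltonian q U ⟨mulMatrix _ f, hf⟩) =
    ∑ s, inclusion s (hamiltonian q (V s) ⟨component s f, _⟩)
  rw [← sum_inclusion_component (mulMatrix (Θ : Matrix (Fin n) (Fin n) ℂ) _)]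
  refine Finset.sum_congr rfl fun s _ => congrArg _ ?_
  rw [hamiltonian_apply_of_eq_mulMatrix ⟨mulMatrix _ f, hf⟩ ⟨component s f, _⟩ (hcomp s f), component,
    mulMatrix_mulMatrix]

end MulMatrix


/-! ### One-sided limits -/

section Limits

variable {n : ℕ} {q : ℝ}

/-- A one-sided interval at `q` has positive measure, hence meets every conull set. This is what
makes one-sided limits of almost-everywhere classes unique. -/
theorem neBot_nhdsGT_inf_ae (q : ℝ) : (𝓝[>] q ⊓ ae (volume : Measure ℝ)).NeBot := by
  refine inf_neBot_iff.2 fun {s} hs {t} ht => ?_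
  obtain ⟨u, hu, hs⟩ := mem_nhdsGT_iff_exists_Ioo_subset.1 hs
  by_contra h
  rw [Set.not_nonempty_iff_eq_empty, ← Set.disjoint_iff_inter_eq_empty] at h
  have h0 := measure_mono_null (hs.trans h.subset_compl_right) (mem_ae_iff.1 ht)
  rw [Real.volume_Ioo, ENNReal.ofReal_eq_zero, sub_nonpos] at h0
  exact absurd hu (not_lt.2 h0)

theorem neBot_nhdsLT_inf_ae (q : ℝ) : (𝓝[<] q ⊓ ae (volume : Measure ℝ)).NeBot := by
  refine inf_neBot_iff.2 fun {s} hs {t} ht => ?_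
  obtain ⟨u, hu, hs⟩ := mem_nhdsLT_iff_exists_Ioo_subset.1 hs
  by_contra h
  rw [Set.not_nonempty_iff_eq_empty, ← Set.disjoint_iff_inter_eq_empty] at h
  have h0 := measure_mono_null (hs.trans h.subset_compl_right) (mem_ae_iff.1 ht)
  rw [Real.volume_Ioo, ENNReal.ofReal_eq_zero, sub_nonpos] at h0
  exact absurd hu (not_lt.2 h0)

theorem HasLimit.unique {l : Filter ℝ} [(l ⊓ ae (volume : Measure ℝ)).NeBot] {f : L2 n}
    {v w : EuclideanSpace ℂ (Fin n)} (hv : HasLimit l f v) (hw : HasLimit l f w) : v = w := by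
  obtain ⟨g, hg, tg⟩ := hv
  obtain ⟨k, hk, tk⟩ := hw
  have hgk : g =ᶠ[l ⊓ ae (volume : Measure ℝ)] k :=
    (hg.symm.trans hk).filter_mono inf_le_right
  exact tendsto_nhds_unique ((tg.mono_left inf_le_left).congr' hgk) (tk.mono_left inf_le_left)

theorem IsContinuousAt.eq_of_hasLimit {f : L2 n} (hf : IsContinuousAt q f)
    {a b : EuclideanSpace ℂ (Fin n)} (ha : HasLimit (𝓝[<] q) f a)
    (hb : HasLimit (𝓝[>] q) f b) : a = b := by
  have := neBot_nhdsGT_inf_ae q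
  have := neBot_nhdsLT_inf_ae q
  obtain ⟨g, hg, t⟩ := hf
  exact (ha.unique ⟨g, hg, t.tendsto.mono_left nhdsWithin_le_nhds⟩).trans
    (hb.unique ⟨g, hg, t.tendsto.mono_left nhdsWithin_le_nhds⟩).symm

theorem IsAnticontinuousAt.add_eq_zero_of_hasLimit {f : L2 n} (hf : IsAnticontinuousAt q f)
    {a b : EuclideanSpace ℂ (Fin n)} (ha : HasLimit (𝓝[<] q) f a)
    (hb : HasLimit (𝓝[>] q) f b) : b + a = 0 := by
  have := neBot_nhdsGT_inf_ae q
  have := neBot_nhdsLT_inf_ae q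
  obtain ⟨c, d, hc, hd, h⟩ := hf
  rw [ha.unique hc, hb.unique hd, h]

end Limits

/-! ### Functions with prescribed boundary values -/

section BoundaryValues

variable {n : ℕ} {q : ℝ}

theorem exists_contDiff_hasCompactSupport {E : Type*} [NormedAddCommGroup E] [NormedSpace ℝ E]
    (q : ℝ) (v w : E) :
    ∃ u : ℝ → E, ContDiff ℝ ∞ u ∧ HasCompactSupport u ∧ u q = v ∧ deriv u q = w := by
  let χ : ContDiffBump q := ⟨1, 2, one_pos, one_lt_two⟩
  have hd : HasDerivAt (fun x : ℝ => v + (x - q) • w) w q := by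
    simpa using (((hasDerivAt_id q).sub_const q).smul_const w).const_add v
  refine ⟨fun x => χ x • (v + (x - q) • w), ?_, χ.hasCompactSupport.smul_right, ?_, ?_⟩
  · exact χ.contDiff.smul (by fun_prop)
  · simp [χ.eventuallyEq_one.eq_of_nhds]
  · refine (hd.congr_of_eventuallyEq ?_).deriv
    filter_upwards [χ.eventuallyEq_one] with x hx
    rw [hx, Pi.one_apply, one_smul]

/-- Integration by parts on a half-line: `h0`, applied to `φ • u`, says that there is no boundary
term, since `φ` vanishes at `q`. Stating it as a hypothesis treats both half-lines at once. -/
theorem hasWeakDeriv_of_indicator {s : Set ℝ} (hs : MeasurableSet s)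
    {u : ℝ → EuclideanSpace ℂ (Fin n)} (hu : ContDiff ℝ ∞ u)
    (h0 : ∀ v : ℝ → EuclideanSpace ℂ (Fin n), ContDiff ℝ 1 v → HasCompactSupport v → v q = 0 →
      ∫ x in s, deriv v x = 0)
    {f g : L2 n} (hf : f =ᵐ[volume] s.indicator u) (hg : g =ᵐ[volume] s.indicator (deriv u)) :
    HasWeakDeriv q f g := by
  intro φ hφ hc hφq
  have hq : φ q = 0 := by
    by_contra h
    exact hφq (subset_tsupport _ h) rfl
  have hφ1 : ContDiff ℝ 1 φ := hφ.of_le (by exact_mod_cast le_top)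
  have hu1 : ContDiff ℝ 1 u := hu.of_le (by exact_mod_cast le_top)
  have key := h0 (fun x => φ x • u x) (hφ1.smul hu1) hc.smul_right (by simp [hq])
  have hder : ∀ x, deriv (fun x => φ x • u x) x = φ x • deriv u x + deriv φ x • u x := fun x =>
    ((hφ1.differentiable one_ne_zero x).hasDerivAt.smul
      (hu1.differentiable one_ne_zero x).hasDerivAt).deriv
  have hi1 : Integrable fun x => φ x • deriv u x :=
    (hφ.continuous.smul (hu1.continuous_deriv le_rfl)).integrable_of_hasCompactSupport
      hc.smul_right
  have hi2 : Integrable fun x => deriv φ x • u x :=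
    ((hφ1.continuous_deriv le_rfl).smul hu.continuous).integrable_of_hasCompactSupport
      hc.deriv.smul_right
  simp only [hder] at key
  rw [integral_add hi1.integrableOn hi2.integrableOn] at key
  have e1 : ∫ x, deriv φ x • f x = ∫ x in s, deriv φ x • u x := by
    rw [← integral_indicator hs]
    refine integral_congr_ae ?_
    filter_upwards [hf] with x hx
    rw [hx, Set.indicator_smul]
  have e2 : ∫ x, φ x • g x = ∫ x in s, φ x • deriv u x := by
    rw [← integral_indicator hs]
    refine integral_congr_ae ?_
    filter_upwards [hg] with x hx
    rw [hx, Set.indicator_smul]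
  rw [e1, e2]
  exact eq_neg_of_add_eq_zero_right key

theorem hasTwoWeakDerivs_indicator {s : Set ℝ} (hs : MeasurableSet s)
    {u : ℝ → EuclideanSpace ℂ (Fin n)} (hu : ContDiff ℝ ∞ u) (hc : HasCompactSupport u)
    (h0 : ∀ v : ℝ → EuclideanSpace ℂ (Fin n), ContDiff ℝ 1 v → HasCompactSupport v → v q = 0 →
      ∫ x in s, deriv v x = 0) :
    ∃ f f' f'' : L2 n, HasTwoWeakDerivs q f f' f'' ∧ f =ᵐ[volume] s.indicator u ∧
      f' =ᵐ[volume] s.indicator (deriv u) := by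
  have hLp : ∀ v : ℝ → EuclideanSpace ℂ (Fin n), ContDiff ℝ ∞ v → HasCompactSupport v →
      ∃ f : L2 n, f =ᵐ[volume] s.indicator v := fun v hv hvc =>
    ⟨_, ((hv.continuous.memLp_of_hasCompactSupport hvc).indicator hs).coeFn_toLp⟩
  have hu' : ContDiff ℝ ∞ (deriv u) := (contDiff_infty_iff_deriv.1 hu).2
  have hu'' : ContDiff ℝ ∞ (deriv (deriv u)) := (contDiff_infty_iff_deriv.1 hu').2
  obtain ⟨f, hf⟩ := hLp u hu hc
  obtain ⟨f', hf'⟩ := hLp _ hu' hc.deriv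
  obtain ⟨f'', hf''⟩ := hLp _ hu'' hc.deriv.deriv
  exact ⟨f, f', f'', ⟨hasWeakDeriv_of_indicator hs hu h0 hf hf',
    hasWeakDeriv_of_indicator hs hu' h0 hf' hf''⟩, hf, hf'⟩

theorem hasLimit_of_indicator {l : Filter ℝ} {s : Set ℝ} {u : ℝ → EuclideanSpace ℂ (Fin n)}
    (hu : ContinuousAt u q) (hl : l ≤ 𝓝 q) (hs : s ∈ l) {f : L2 n}
    (hf : f =ᵐ[volume] s.indicator u) : HasLimit l f (u q) := by
  refine ⟨_, hf, (hu.tendsto.mono_left hl).congr' ?_⟩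
  filter_upwards [hs] with x hx
  rw [Set.indicator_of_mem hx]

theorem hasLimit_zero_of_indicator {l : Filter ℝ} {s : Set ℝ}
    {u : ℝ → EuclideanSpace ℂ (Fin n)} (hs : sᶜ ∈ l) {f : L2 n}
    (hf : f =ᵐ[volume] s.indicator u) : HasLimit l f 0 := by
  refine ⟨_, hf, tendsto_const_nhds.congr' ?_⟩
  filter_upwards [hs] with x hx
  rw [Set.indicator_of_notMem hx]

theorem exists_hasTwoWeakDerivs_hasLimit (q : ℝ) (a b a' b' : EuclideanSpace ℂ (Fin n)) :
    ∃ f f' f'' : L2 n, HasTwoWeakDerivs q f f' f'' ∧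
      HasLimit (𝓝[<] q) f a ∧ HasLimit (𝓝[>] q) f b ∧
      HasLimit (𝓝[<] q) f' a' ∧ HasLimit (𝓝[>] q) f' b' := by
  obtain ⟨u, hu, huc, rfl, rfl⟩ := exists_contDiff_hasCompactSupport q a a'
  obtain ⟨v, hv, hvc, rfl, rfl⟩ := exists_contDiff_hasCompactSupport q b b'
  obtain ⟨f, f', f'', hf, h1, h2⟩ := hasTwoWeakDerivs_indicator (q := q) measurableSet_Iic hu huc
    fun w hw hwc h => by rw [hwc.integral_Iic_deriv_eq hw q, h]
  obtain ⟨g, g', g'', hg, k1, k2⟩ := hasTwoWeakDerivs_indicator (q := q) measurableSet_Ioi hv hvc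
    fun w hw hwc h => by rw [hwc.integral_Ioi_deriv_eq hw q, h, neg_zero]
  have hl : Set.Iic q ∈ 𝓝[<] q := mem_of_superset self_mem_nhdsWithin Set.Iio_subset_Iic_self
  have hr : Set.Ioi q ∈ 𝓝[>] q := self_mem_nhdsWithin
  have hu' : Continuous (deriv u) := hu.continuous_deriv (by simp)
  have hv' : Continuous (deriv v) := hv.continuous_deriv (by simp)
  have hl' : (Set.Ioi q)ᶜ ∈ 𝓝[<] q := by rwa [Set.compl_Ioi]
  have hr' : (Set.Iic q)ᶜ ∈ 𝓝[>] q := by rwa [Set.compl_Iic]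
  refine ⟨f + g, f' + g', f'' + g'', ⟨hf.1.add hg.1, hf.2.add hg.2⟩, ?_, ?_, ?_, ?_⟩
  · simpa using (hasLimit_of_indicator hu.continuous.continuousAt nhdsWithin_le_nhds hl h1).add
      (hasLimit_zero_of_indicator hl' k1)
  · simpa using (hasLimit_zero_of_indicator hr' h1).add
      (hasLimit_of_indicator hv.continuous.continuousAt nhdsWithin_le_nhds hr k1)
  · simpa using (hasLimit_of_indicator hu'.continuousAt nhdsWithin_le_nhds hl h2).add
      (hasLimit_zero_of_indicator hl' k2)
  · simpa using (hasLimit_zero_of_indicator hr' h2).add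
      (hasLimit_of_indicator hv'.continuousAt nhdsWithin_le_nhds hr k2)

end BoundaryValues


/-! ### Boundary conditions of mirror form -/

section Mirror

variable {m n : ℕ} {q : ℝ} {σ η : ℂ}

/-- The block matrix `[A, σ (A - η); σ (A - η), A]`. -/
def mirror (σ η : ℂ) (A : Matrix (Fin n) (Fin n) ℂ) :
    Matrix (Fin n ⊕ Fin n) (Fin n ⊕ Fin n) ℂ :=
  Matrix.fromBlocks A (σ • (A - η • 1)) (σ • (A - η • 1)) A

/-- Each block is an affine function of `A` with scalar coefficients, so it inherits the relation
satisfied by `A`. -/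
theorem fromBlocks_mul_mirror {M : Matrix (Fin m) (Fin n) ℂ} {A : Matrix (Fin n) (Fin n) ℂ}
    {A' : Matrix (Fin m) (Fin m) ℂ} (h : M * A = A' * M) :
    Matrix.fromBlocks M 0 0 M * mirror σ η A = mirror σ η A' * Matrix.fromBlocks M 0 0 M := by
  simp [mirror, Matrix.fromBlocks_multiply, Matrix.mul_sub, Matrix.sub_mul, h]

/-- The diagonal blocks of `UU* - 1` equal `2AA* - η(A + A*)` and the off-diagonal ones are `σ`
times the same expression. -/
theorem mirror_mem_unitaryGroup (hσ : σ = 1 ∨ σ = -1) (hη : η = 1 ∨ η = -1)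
    {A : Matrix (Fin n) (Fin n) ℂ}
    (h : (2 : ℂ) • (A * A.conjTranspose) = η • (A + A.conjTranspose)) :
    mirror σ η A ∈ Matrix.unitaryGroup (Fin n ⊕ Fin n) ℂ := by
  rw [Matrix.mem_unitaryGroup_iff, Matrix.star_eq_conjTranspose, mirror,
    Matrix.fromBlocks_conjTranspose, Matrix.fromBlocks_multiply, ← Matrix.fromBlocks_one]
  congr 1 <;> rcases hσ with rfl | rfl <;> rcases hη with rfl | rfl <;>
    simp only [one_smul, neg_smul, Matrix.conjTranspose_sub, Matrix.conjTranspose_neg,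
      Matrix.conjTranspose_one, mul_sub, sub_mul, mul_neg, neg_mul, mul_one, one_mul] at h ⊢ <;>
    first
      | linear_combination (norm := module) h
      | linear_combination (norm := module) -h

theorem eq_mirror (hσ : σ = 1 ∨ σ = -1) (hη : η = 1 ∨ η = -1)
    {U : Matrix (Fin n ⊕ Fin n) (Fin n ⊕ Fin n) ℂ}
    (hU : U ∈ Matrix.unitaryGroup (Fin n ⊕ Fin n) ℂ)
    (h : ∀ i k, (U - η • 1) (Sum.inl i) k = σ * (U - η • 1) (Sum.inr i) k) :
    ∃ A : Matrix (Fin n) (Fin n) ℂ, U = mirror σ η A ∧ A * A.conjTranspose = A.conjTranspose * A ∧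
      (2 : ℂ) • (A * A.conjTranspose) = η • (A + A.conjTranspose) := by
  have hU' := Matrix.mem_unitaryGroup_iff'.1 hU
  rw [Matrix.mem_unitaryGroup_iff] at hU
  obtain ⟨A, B, C, D, rfl⟩ : ∃ A B C D : Matrix (Fin n) (Fin n) ℂ, U = Matrix.fromBlocks A B C D :=
    ⟨_, _, _, _, (Matrix.fromBlocks_toBlocks U).symm⟩
  rw [← Matrix.fromBlocks_one, Matrix.fromBlocks_smul] at h
  have hA : A - η • 1 = σ • C := by
    ext i j
    simpa using h i (Sum.inl j)
  have hB : B = σ • (D - η • 1) := by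
    ext i j
    simpa using h i (Sum.inr j)
  rw [Matrix.star_eq_conjTranspose, Matrix.fromBlocks_conjTranspose, Matrix.fromBlocks_multiply,
    ← Matrix.fromBlocks_one, Matrix.fromBlocks_inj] at hU hU'
  obtain ⟨h1, -, h3, h4⟩ := hU
  obtain ⟨k1, -, -, -⟩ := hU'
  have hA' : A = σ • C + η • 1 := by rw [← hA]; abel
  -- Substituting for `A` and `B` in `CA* + DB* = 0` and using `CC* + DD* = 1` leaves `σ + ηC - σηD
  -- = 0`, that is, `C = σ(D - η) = B`.
  have hCB : C = B := by
    rw [hA', hB] at h3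
    rw [hB]
    clear h1 k1 hA hB hA' h
    rcases hσ with rfl | rfl <;> rcases hη with rfl | rfl <;>
      simp only [one_smul, neg_smul, Matrix.conjTranspose_sub, Matrix.conjTranspose_neg,
        Matrix.conjTranspose_add, Matrix.conjTranspose_one, mul_sub, mul_neg, mul_one, mul_add]
        at h3 h4 ⊢ <;>
      first
        | linear_combination (norm := module) h3 - h4
        | linear_combination (norm := module) h3 + h4
        | linear_combination (norm := module) -h3 - h4
        | linear_combination (norm := module) -h3 + h4
  have hAD : A = D := by
    rw [hA', hCB, hB, smul_smul]
    rcases hσ with rfl | rfl <;> simp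
  subst hAD hCB
  -- The upper left blocks of `UU* = 1` and `U*U = 1` have the same right-hand side once expanded,
  -- which is where normality of `A` comes from.
  have key : (2 : ℂ) • (A * A.conjTranspose) = η • (A + A.conjTranspose) ∧
      (2 : ℂ) • (A.conjTranspose * A) = η • (A + A.conjTranspose) := by
    rw [hB] at h1 k1
    clear h3 h4 hA hB hA' h
    rcases hσ with rfl | rfl <;> rcases hη with rfl | rfl <;>
      simp only [one_smul, neg_smul, Matrix.conjTranspose_sub, Matrix.conjTranspose_neg,
        Matrix.conjTranspose_one, mul_sub, sub_mul, mul_neg, neg_mul, mul_one, one_mul]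
        at h1 k1 ⊢ <;>
      exact ⟨by linear_combination (norm := module) h1, by linear_combination (norm := module) k1⟩
  refine ⟨A, by rw [mirror, ← hB], ?_, key.1⟩
  exact smul_right_injective _ (two_ne_zero (α := ℂ)) (key.1.trans key.2.symm)

theorem isReducible_of_mirror (hσ : σ = 1 ∨ σ = -1) (hη : η = 1 ∨ η = -1)
    (U : Matrix.unitaryGroup (Fin n ⊕ Fin n) ℂ)
    (h : ∀ i k, ((U : Matrix (Fin n ⊕ Fin n) (Fin n ⊕ Fin n) ℂ) - η • 1) (Sum.inl i) k =
      σ * ((U : Matrix (Fin n ⊕ Fin n) (Fin n ⊕ Fin n) ℂ) - η • 1) (Sum.inr i) k) :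
    IsReducible q (hamiltonian q U) := by
  obtain ⟨A, hUA, hA, hA2⟩ := eq_mirror hσ hη U.2 h
  obtain ⟨P, d, hPd⟩ := exists_unitary_diagonalization A hA
  set P' : Matrix (Fin n) (Fin n) ℂ := P.val
  have hP : P'.conjTranspose * P' = 1 := Matrix.mem_unitaryGroup_iff'.1 P.2
  have hP' : P' * P'.conjTranspose = 1 := Matrix.mem_unitaryGroup_iff.1 P.2
  have hD : P'.conjTranspose * A * P' = Matrix.diagonal d := by
    rw [Matrix.mul_assoc, hPd, ← Matrix.mul_assoc, hP, Matrix.one_mul]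
  have hPA : P'.conjTranspose * A = Matrix.diagonal d * P'.conjTranspose := by
    rw [← hD, Matrix.mul_assoc _ P', hP', Matrix.mul_one]
  have hD' : P'.conjTranspose * A.conjTranspose * P' = (Matrix.diagonal d).conjTranspose := by
    rw [← hD, Matrix.conjTranspose_mul, Matrix.conjTranspose_mul,
      Matrix.conjTranspose_conjTranspose, Matrix.mul_assoc]
  have hdD : (2 : ℂ) • (Matrix.diagonal d * (Matrix.diagonal d).conjTranspose) =
      η • (Matrix.diagonal d + (Matrix.diagonal d).conjTranspose) := by
    have hconj := congrArg (fun X => P'.conjTranspose * X * P') hA2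
    simp only [Matrix.mul_smul, Matrix.smul_mul, Matrix.mul_add, Matrix.add_mul, hD, hD'] at hconj
    rw [← hconj, ← hD', ← Matrix.mul_assoc, ← Matrix.mul_assoc, ← hPA]
    simp only [Matrix.mul_assoc]
  have hd : ∀ s, 2 * (d s * star (d s)) = η * (d s + star (d s)) := by
    intro s
    simpa [Matrix.diagonal_conjTranspose] using congrFun (congrFun hdD s) s
  have hV : ∀ s, mirror σ η (d s • (1 : Matrix (Fin 1) (Fin 1) ℂ)) ∈
      Matrix.unitaryGroup (Fin 1 ⊕ Fin 1) ℂ := by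
    refine fun s => mirror_mem_unitaryGroup hσ hη ?_
    rw [Matrix.conjTranspose_smul, Matrix.conjTranspose_one, Matrix.smul_mul, Matrix.one_mul,
      smul_smul, smul_smul, ← add_smul, smul_smul, mul_assoc, hd]
  -- `Θ = P⁻¹` because `P⁻¹ A P` is diagonal; row `s` of `P⁻¹` and column `s` of `P` are then left
  -- and right eigenvectors of `A` for `d s`.
  refine isReducible_of_intertwines U P⁻¹ (fun s => ⟨_, hV s⟩) (fun s => ?_) (fun s => ?_)
  · rw [Intertwines, hUA]
    refine fromBlocks_mul_mirror ?_
    change Matrix.single 0 s 1 * P'.conjTranspose * A =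
      d s • 1 * (Matrix.single 0 s 1 * P'.conjTranspose)
    rw [Matrix.mul_assoc, hPA, ← Matrix.mul_assoc, Matrix.smul_mul, Matrix.one_mul,
      ← Matrix.smul_mul]
    congr 1
    ext i j
    by_cases hj : s = j <;> simp [Matrix.mul_diagonal, Matrix.single_apply, hj]
  · rw [Intertwines, hUA, inv_inv]
    refine fromBlocks_mul_mirror ?_
    change P' * Matrix.single s 0 1 * (d s • 1) = A * (P' * Matrix.single s 0 1)
    rw [← Matrix.mul_assoc, hPd, Matrix.mul_assoc, Matrix.mul_assoc, Matrix.mul_smul,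
      Matrix.mul_one]
    congr 1
    ext i j
    by_cases hi : s = i <;> simp [Matrix.diagonal_mul, Matrix.single_apply, hi]

end Mirror

/-! ### The boundary values of functions in the domain -/

section Domain

variable {n : ℕ}

theorem exists_mem_domain_boundaryValues (q : ℝ) (U : Matrix.unitaryGroup (Fin n ⊕ Fin n) ℂ)
    (z : Fin n ⊕ Fin n → ℂ) :
    ∃ f ∈ (hamiltonian q U).domain, ∃ f' a b a' b', HasWeakDeriv q f f' ∧
      HasLimit (𝓝[<] q) f a ∧ HasLimit (𝓝[>] q) f b ∧
      HasLimit (𝓝[<] q) f' a' ∧ HasLimit (𝓝[>] q) f' b' ∧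
      pair a b = Complex.I •
        Matrix.mulVec (1 + (U : Matrix (Fin n ⊕ Fin n) (Fin n ⊕ Fin n) ℂ)) z ∧
      pair (-a') b' = Matrix.mulVec (1 - (U : Matrix (Fin n ⊕ Fin n) (Fin n ⊕ Fin n) ℂ)) z := by
  have hpair : ∀ x : Fin n ⊕ Fin n → ℂ, ∃ a b : EuclideanSpace ℂ (Fin n), pair a b = x :=
    fun x => ⟨WithLp.toLp 2 (x ∘ Sum.inl), WithLp.toLp 2 (x ∘ Sum.inr), by
      ext i; cases i <;> simp [pair]⟩
  obtain ⟨a, b, hab⟩ := hpair (Complex.I •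
    Matrix.mulVec (1 + (U : Matrix (Fin n ⊕ Fin n) (Fin n ⊕ Fin n) ℂ)) z)
  obtain ⟨a', b', hab'⟩ := hpair
    (Matrix.mulVec (1 - (U : Matrix (Fin n ⊕ Fin n) (Fin n ⊕ Fin n) ℂ)) z)
  -- The sign on `a'` cancels the one in `Γ₂ f = (-f'(q-), f'(q+))`.
  obtain ⟨f, f', f'', h, h1, h2, h3, h4⟩ := exists_hasTwoWeakDerivs_hasLimit q a b (-a') b'
  refine ⟨f, ⟨f', f'', h, a, b, -a', b', h1, h2, h3, h4, ?_⟩, f', a, b, -a', b', h.1, h1, h2, h3,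
    h4, hab, by rw [neg_neg, hab']⟩
  rw [neg_neg, hab, hab', Matrix.mulVec_smul, Matrix.mulVec_mulVec, Matrix.mulVec_mulVec]
  -- What remains is `(1 - U)(1 + U) = (1 + U)(1 - U)`.
  congr 2
  noncomm_ring

theorem apply_inl_eq_of_mulVec {σ : ℂ} {M : Matrix (Fin n ⊕ Fin n) (Fin n ⊕ Fin n) ℂ}
    (h : ∀ z i, M.mulVec z (Sum.inl i) = σ * M.mulVec z (Sum.inr i)) (i : Fin n)
    (k : Fin n ⊕ Fin n) : M (Sum.inl i) k = σ * M (Sum.inr i) k := by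
  simpa using h (Pi.single k 1) i

theorem isReducible_of_values {q : ℝ} {σ : ℂ} (hσ : σ = 1 ∨ σ = -1)
    (U : Matrix.unitaryGroup (Fin n ⊕ Fin n) ℂ)
    (h : ∀ f ∈ (hamiltonian q U).domain, ∀ a b, HasLimit (𝓝[<] q) f a →
      HasLimit (𝓝[>] q) f b → a = σ • b) :
    IsReducible q (hamiltonian q U) := by
  refine isReducible_of_mirror (η := -1) hσ (Or.inr rfl) U
    (apply_inl_eq_of_mulVec fun z i => ?_)
  obtain ⟨f, hf, f', a, b, a', b', -, ha, hb, -, -, hab, -⟩ :=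
    exists_mem_domain_boundaryValues q U z
  rw [neg_one_smul, sub_neg_eq_add, add_comm]
  have h1 := congrFun hab (Sum.inl i)
  have h2 := congrFun hab (Sum.inr i)
  rw [h f hf a b ha hb] at h1
  simp only [pair, Sum.elim_inl, Sum.elim_inr, Pi.smul_apply, PiLp.smul_apply, smul_eq_mul]
    at h1 h2
  refine mul_left_cancel₀ Complex.I_ne_zero ?_
  rw [← h1, h2]
  ring

theorem isReducible_of_derivatives {q : ℝ} {σ : ℂ} (hσ : σ = 1 ∨ σ = -1)
    (U : Matrix.unitaryGroup (Fin n ⊕ Fin n) ℂ)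
    (h : ∀ f ∈ (hamiltonian q U).domain, ∀ f' a' b', HasWeakDeriv q f f' →
      HasLimit (𝓝[<] q) f' a' → HasLimit (𝓝[>] q) f' b' → -a' = σ • b') :
    IsReducible q (hamiltonian q U) := by
  refine isReducible_of_mirror (η := 1) hσ (Or.inl rfl) U
    (apply_inl_eq_of_mulVec fun z i => ?_)
  obtain ⟨f, hf, f', a, b, a', b', hf', -, -, ha, hb, -, hab⟩ :=
    exists_mem_domain_boundaryValues q U z
  rw [one_smul, ← neg_sub 1, Matrix.neg_mulVec]
  have h1 := congrFun hab (Sum.inl i)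
  have h2 := congrFun hab (Sum.inr i)
  rw [h f hf f' a' b' hf' ha hb] at h1
  simp only [pair, Sum.elim_inl, Sum.elim_inr, PiLp.smul_apply, smul_eq_mul] at h1 h2
  rw [Pi.neg_apply, Pi.neg_apply, ← h1, ← h2]
  ring

end Domain

end CoupledChannels

theorem mainTheorem6 (n : ℕ) (q : ℝ) (U : Matrix.unitaryGroup (Fin n ⊕ Fin n) ℂ)
    (h :
      (∀ f ∈ (CoupledChannels.hamiltonian q U).domain, CoupledChannels.IsContinuousAt q f) ∨
      (∀ f ∈ (CoupledChannels.hamiltonian q U).domain, CoupledChannels.IsAnticontinuousAt q f) ∨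
      (∀ f ∈ (CoupledChannels.hamiltonian q U).domain, ∀ f' : CoupledChannels.L2 n,
        CoupledChannels.HasWeakDeriv q f f' → CoupledChannels.IsContinuousAt q f') ∨
      (∀ f ∈ (CoupledChannels.hamiltonian q U).domain, ∀ f' : CoupledChannels.L2 n,
        CoupledChannels.HasWeakDeriv q f f' → CoupledChannels.IsAnticontinuousAt q f')) :
    CoupledChannels.IsReducible q (CoupledChannels.hamiltonian q U) := by
  rcases h with h | h | h | h
  · refine CoupledChannels.isReducible_of_values (σ := 1) (Or.inl rfl) U fun f hf a b ha hb => ?_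
    rw [one_smul]
    exact (h f hf).eq_of_hasLimit ha hb
  · refine CoupledChannels.isReducible_of_values (σ := -1) (Or.inr rfl) U fun f hf a b ha hb => ?_
    rw [neg_one_smul]
    exact eq_neg_of_add_eq_zero_right ((h f hf).add_eq_zero_of_hasLimit ha hb)
  -- The signs are swapped relative to the first two cases: the left entry of `Γ₂` is `-f'(q-)`, so
  -- continuity of `f'` is the antisymmetric case and anticontinuity the symmetric one.
  · refine CoupledChannels.isReducible_of_derivatives (σ := -1) (Or.inr rfl) U
      fun f hf f' a b hf' ha hb => ?_
    rw [neg_one_smul, (h f hf f' hf').eq_of_hasLimit ha hb]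
  · refine CoupledChannels.isReducible_of_derivatives (σ := 1) (Or.inl rfl) U
      fun f hf f' a b hf' ha hb => ?_
    rw [one_smul]
    exact neg_eq_of_add_eq_zero_left ((h f hf f' hf').add_eq_zero_of_hasLimit ha hb)
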